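/- Let $d \ge 0$ be an integer and let $\Omega \subset \mathbb{R}^d$ be a convex body, that is, a compact convex set with nonempty interior. Suppose that $\Omega$ is spectral, that is, there is a countable set $\Lambda \subset \mathbb{R}^d$ such that the system of exponential functions $e_\lambda(x) = e^{2\pi i \langle \lambda, x\rangle}$, $\lambda \in \Lambda$, is orthogonal and complete in $L^2(\Omega)$ (taken with respect to Lebesgue measure). Then $\Omega$ is a convex polytope, that is, the convex hull of a finite set of points. -/

import Mathlib

open MeasureTheory

noncomputable section

/-- The exponential function `x ↦ exp (2πi⟨ξ, x⟩)` on Euclidean space with frequency `ξ`. -/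
def expFun {d : ℕ} (ξ x : EuclideanSpace ℝ (Fin d)) : ℂ :=
  Complex.exp (2 * Real.pi * Complex.I * (inner ℝ ξ x : ℝ))

theorem memLp_expFun {d : ℕ} {Ω : Set (EuclideanSpace ℝ (Fin d))} (hΩ : Bornology.IsBounded Ω)
    (ξ : EuclideanSpace ℝ (Fin d)) : MemLp (expFun ξ) 2 (volume.restrict Ω) := by
  have : IsFiniteMeasure (volume.restrict Ω) :=
    ⟨by rw [Measure.restrict_apply_univ]; exact hΩ.measure_lt_top⟩
  have hc : Continuous (expFun ξ) := by unfold expFun; fun_prop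
  refine MemLp.of_bound hc.aestronglyMeasurable 1 (Filter.Eventually.of_forall fun x => ?_)
  have h : (2 * Real.pi * Complex.I * (inner ℝ ξ x : ℝ) : ℂ)
      = ((2 * Real.pi * inner ℝ ξ x : ℝ) : ℂ) * Complex.I := by push_cast; ring
  rw [expFun, h, Complex.norm_exp_ofReal_mul_I]

/-- The exponential function with frequency `ξ`, as an element of `L²(Ω)` for bounded `Ω`. -/
def expLp {d : ℕ} {Ω : Set (EuclideanSpace ℝ (Fin d))} (hΩ : Bornology.IsBounded Ω)
    (ξ : EuclideanSpace ℝ (Fin d)) : Lp ℂ 2 (volume.restrict Ω) :=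
  (memLp_expFun hΩ ξ).toLp (expFun ξ)

/-- `Λ` is a spectrum for the bounded set `Ω`: it is countable, and the exponential functions with
frequencies in `Λ` form an orthogonal and complete system in `L²(Ω)`. -/
structure IsSpectrum {d : ℕ} {Ω : Set (EuclideanSpace ℝ (Fin d))} (hΩ : Bornology.IsBounded Ω)
    (Λ : Set (EuclideanSpace ℝ (Fin d))) : Prop where
  countable : Λ.Countable
  orthogonal : ∀ ξ ∈ Λ, ∀ η ∈ Λ, ξ ≠ η → inner ℂ (expLp hΩ ξ) (expLp hΩ η) = 0
  complete : (Submodule.span ℂ (expLp hΩ '' Λ)).topologicalClosure = ⊤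

/-- A spectral set: a bounded, measurable set of positive Lebesgue measure that has a spectrum. -/
def IsSpectral {d : ℕ} (Ω : Set (EuclideanSpace ℝ (Fin d))) : Prop :=
  MeasurableSet Ω ∧ 0 < volume Ω ∧
    ∃ hΩ : Bornology.IsBounded Ω, ∃ Λ : Set (EuclideanSpace ℝ (Fin d)), IsSpectrum hΩ Λ

/-- A convex body: a compact convex set with nonempty interior. (Mathlib's `ConvexBody` asks only
that the set be nonempty.) -/
structure IsConvexBody {d : ℕ} (K : Set (EuclideanSpace ℝ (Fin d))) : Prop where
  isCompact : IsCompact K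
  convex : Convex ℝ K
  nonempty_interior : (interior K).Nonempty

/-- A convex polytope: the convex hull of a finite set of points. -/
def IsConvexPolytope {d : ℕ} (P : Set (EuclideanSpace ℝ (Fin d))) : Prop :=
  ∃ s : Set (EuclideanSpace ℝ (Fin d)), s.Finite ∧ P = convexHull ℝ s

end

/-! A spectrum yields positive measures that give mass one to every translate of `Ω` and have almost
all of the mass of one such translate in a tiny ball at the origin. Such measures leave room for
only finitely many facet directions.

Analytic half (`IsSpectrum.exists_measure`). For real weights `w` put `G = |∑ w_ξ e_ξ|²`.
Orthogonality gives `G` the same integral `|Ω| ∑ w_ξ²` over each translate of `Ω`. For a bump `ψ`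
supported in a small ball inside `Ω`, `∑∑ w_ξ w_η |ψ̂(ξ - η)|²` equals the integral of `G` against
the autocorrelation of `ψ`, hence is at most `∫ψ²` times the integral of `G` near the origin. By
Parseval the kernel `|ψ̂(ξ - η)|²` has constant row sums `|Ω| ∫ψ²`, and slowly decaying weights
almost attain this value as a Rayleigh quotient. Normalising `G` then gives the measure.

Geometric half (`IsConvexBody.finite_regularNormals`). Take boundary points `x` touched by an inner
ball, with outer normal `n`; the translate `K - x - τn` avoids the ball of radius `τ` at the origin,
so its unit mass lies away from the origin. For distinct normals and small `τ`, two such translates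
meet only at points `u` for which `0` and `u` are both interior to a common translate `K - a`. The
mass of `K - a` is nearly all at the origin, so the overlaps are negligible. Almost disjoint sets of
mass one inside a fixed ball of bounded mass are bounded in number. No limit measure is needed.
Finally, the supporting half-spaces at regular normals cut out `K`, and finitely many of them bound
a polytope. -/

/-! ### Polytopes from half-spaces -/

/-- A bounded intersection of finitely many closed half-spaces is a convex polytope. -/
theorem isConvexPolytope_of_finite_halfSpaces {d : ℕ} {N : Set (EuclideanSpace ℝ (Fin d))}
    (hN : N.Finite) (c : EuclideanSpace ℝ (Fin d) → ℝ)
    (hc : IsCompact {x : EuclideanSpace ℝ (Fin d) | ∀ n ∈ N, inner ℝ n x ≤ c n}) :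
    IsConvexPolytope {x : EuclideanSpace ℝ (Fin d) | ∀ n ∈ N, inner ℝ n x ≤ c n} := by
  set P : Set (EuclideanSpace ℝ (Fin d)) := {x | ∀ n ∈ N, inner ℝ n x ≤ c n} with hP
  have hconv : Convex ℝ P := by
    intro x hx y hy a b ha hb hab n hn
    rw [inner_add_right, inner_smul_right, inner_smul_right]
    have h1 := mul_le_mul_of_nonneg_left (hx n hn) ha
    have h2 := mul_le_mul_of_nonneg_left (hy n hn) hb
    calc _ ≤ a * c n + b * c n := add_le_add h1 h2
      _ = c n := by rw [← add_mul, hab, one_mul]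
  -- An extreme point is determined by its active constraints: if `x` and `y` share them, `x` can be
  -- moved slightly away from `y` inside `P`, so `x` is inside a segment of `P` ending at `y`.
  have hinj : Set.InjOn (fun x => {n ∈ N | inner ℝ n x = c n}) (Set.extremePoints ℝ P) := by
    intro x hx y hy hxy
    have key : ∀ᶠ ε : ℝ in nhdsWithin 0 (Set.Ioi 0), x - ε • (y - x) ∈ P := by
      refine (hN.eventually_all (p := fun n (ε : ℝ) => inner ℝ n (x - ε • (y - x)) ≤ c n)).2 ?_
      intro n hn
      by_cases hact : inner ℝ n x = c n
      · have hy' : n ∈ {n ∈ N | inner ℝ n y = c n} := by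
          have : n ∈ {n ∈ N | inner ℝ n x = c n} := ⟨hn, hact⟩
          simpa only using hxy.subset this
        refine Filter.Eventually.of_forall fun ε => ?_
        rw [inner_sub_right, inner_smul_right, inner_sub_right, hy'.2, hact]
        simp
      · have hlt : inner ℝ n x < c n := lt_of_le_of_ne (hx.1 n hn) hact
        have hcont : Continuous fun ε : ℝ => inner ℝ n (x - ε • (y - x)) := by fun_prop
        have := hcont.tendsto 0
        simp only [zero_smul, sub_zero] at this
        exact ((this.eventually_lt_const hlt).mono fun ε h => h.le).filter_mono
          nhdsWithin_le_nhds
    obtain ⟨ε, hεP, hε⟩ := (key.and self_mem_nhdsWithin).exists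
    have hε : 0 < ε := hε
    by_contra hne
    have hmem : x ∈ openSegment ℝ (x - ε • (y - x)) y := by
      refine ⟨1 / (1 + ε), ε / (1 + ε), by positivity, by positivity, by field_simp, ?_⟩
      have h1 : (1 + ε) ≠ 0 := by positivity
      rw [← sub_eq_zero]
      have : (1 / (1 + ε)) • (x - ε • (y - x)) + (ε / (1 + ε)) • y - x
          = ((1 / (1 + ε)) * (1 + ε) - 1) • x := by
        module
      rw [this, one_div_mul_cancel h1, sub_self, zero_smul]
    exact hne ((mem_extremePoints.1 hx).2 _ hεP _ hy.1 hmem).2.symm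
  have hfin : (Set.extremePoints ℝ P).Finite := by
    refine Set.Finite.of_finite_image (hN.finite_subsets.subset ?_) hinj
    rintro _ ⟨x, -, rfl⟩
    exact Set.sep_subset _ _
  refine ⟨_, hfin, ?_⟩
  exact (closure_convexHull_extremePoints hc hconv).symm.trans
    (hfin.isClosed_convexHull ℝ).closure_eq

/-! ### Regular normals of a convex body -/

/-- `n` is a unit outer normal vector of `K` at the point `x`, and a ball contained in `K` touches
the boundary of `K` at `x`. -/
structure IsRegularNormal {d : ℕ} (K : Set (EuclideanSpace ℝ (Fin d)))
    (x n : EuclideanSpace ℝ (Fin d)) : Prop where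
  mem : x ∈ K
  norm_eq : ‖n‖ = 1
  le : ∀ y ∈ K, inner ℝ n y ≤ inner ℝ n x
  ball : ∃ r > 0, Metric.closedBall (x - r • n) r ⊆ K

/-- A supporting functional at the touching point of an inner ball is normal to the ball. -/
theorem eq_of_closedBall_subset {d : ℕ} {K : Set (EuclideanSpace ℝ (Fin d))}
    {x n m : EuclideanSpace ℝ (Fin d)} {r : ℝ} (hr : 0 < r) (hn : ‖n‖ = 1) (hm : ‖m‖ = 1)
    (hK : Metric.closedBall (x - r • n) r ⊆ K) (h : ∀ y ∈ K, inner ℝ m y ≤ inner ℝ m x) :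
    m = n := by
  -- The point of the ball farthest in direction `m`; comparison with `x` forces `⟨m, n⟩ ≥ 1`.
  have hy := h (x - r • n + r • m) (hK (by
    rw [mem_closedBall_iff_norm, add_sub_cancel_left, norm_smul, hm, Real.norm_of_nonneg hr.le,
      mul_one]))
  rw [inner_add_right, inner_sub_right, inner_smul_right, inner_smul_right,
    real_inner_self_eq_norm_sq, hm] at hy
  have h1 : 1 ≤ inner ℝ m n := by nlinarith
  have h2 : inner ℝ m n = 1 :=
    le_antisymm ((real_inner_le_norm m n).trans (by rw [hm, hn, one_mul])) h1
  exact (inner_eq_one_iff_of_norm_eq_one hm hn).1 h2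

theorem IsRegularNormal.unique {d : ℕ} {K : Set (EuclideanSpace ℝ (Fin d))}
    {x n m : EuclideanSpace ℝ (Fin d)} (h : IsRegularNormal K x n) (hm : ‖m‖ = 1)
    (hle : ∀ y ∈ K, inner ℝ m y ≤ inner ℝ m x) : m = n := by
  obtain ⟨r, hr, hb⟩ := h.ball
  exact eq_of_closedBall_subset hr h.norm_eq hm hb hle

/-- A point outside the interior of a convex body has a unit outer normal. -/
theorem IsConvexBody.exists_normal {d : ℕ} {K : Set (EuclideanSpace ℝ (Fin d))}
    (hK : IsConvexBody K) {x : EuclideanSpace ℝ (Fin d)} (hx : x ∉ interior K) :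
    ∃ n : EuclideanSpace ℝ (Fin d), ‖n‖ = 1 ∧ ∀ y ∈ K, inner ℝ n y ≤ inner ℝ n x := by
  obtain ⟨f, hf⟩ := geometric_hahn_banach_open_point hK.convex.interior isOpen_interior hx
  obtain ⟨p, hp⟩ := hK.nonempty_interior
  set v := (InnerProductSpace.toDual ℝ (EuclideanSpace ℝ (Fin d))).symm f with hv
  have hfv : ∀ y, f y = inner ℝ v y := fun y => by
    rw [hv, InnerProductSpace.toDual_symm_apply]
  have hv0 : v ≠ 0 := by
    intro h0
    have := hf p hp
    simp [hfv, h0] at this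
  have hle : ∀ y ∈ K, inner ℝ v y ≤ inner ℝ v x := by
    intro y hy
    have hcl : y ∈ closure (interior K) := by
      rw [hK.convex.closure_interior_eq_closure_of_nonempty_interior hK.nonempty_interior]
      exact subset_closure hy
    refine closure_minimal (s := interior K) (t := {y | inner ℝ v y ≤ inner ℝ v x}) ?_ ?_ hcl
    · intro z hz
      have := hf z hz
      rw [hfv, hfv] at this
      exact this.le
    · exact isClosed_le (by fun_prop) continuous_const
  refine ⟨‖v‖⁻¹ • v, norm_smul_inv_norm hv0, fun y hy => ?_⟩
  rw [inner_smul_left, inner_smul_left]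
  exact mul_le_mul_of_nonneg_left (hle y hy) (by simp)

/-- The half-spaces given by regular normals separate a convex body from every outside point. -/
theorem IsConvexBody.exists_isRegularNormal {d : ℕ} {K : Set (EuclideanSpace ℝ (Fin d))}
    (hK : IsConvexBody K) {z : EuclideanSpace ℝ (Fin d)} (hz : z ∉ K) :
    ∃ x n, IsRegularNormal K x n ∧ inner ℝ n x < inner ℝ n z := by
  obtain ⟨p, hp⟩ := hK.nonempty_interior
  obtain ⟨r, hr, hball⟩ := Metric.nhds_basis_closedBall.mem_iff.1 (mem_interior_iff_mem_nhds.1 hp)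
  have hclosed : IsClosed K := hK.isCompact.isClosed
  obtain ⟨q, hqseg, hqK, hqi⟩ : ∃ q ∈ segment ℝ p z, q ∈ K ∧ q ∉ interior K := by
    by_contra! hcon
    rcases isPreconnected_iff_subset_of_disjoint.1 (convex_segment p z).isPreconnected
      (interior K) Kᶜ isOpen_interior hclosed.isOpen_compl
      (fun q hq => (em (q ∈ K)).imp (hcon q hq) id)
      (by
        have : interior K ∩ Kᶜ = ∅ :=
          (Set.disjoint_compl_right_iff_subset.2 interior_subset).inter_eq
        rw [this, Set.inter_empty]) with h | h
    · exact hz (interior_subset (h (right_mem_segment ℝ p z)))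
    · exact h (left_mem_segment ℝ p z) (interior_subset hp)
  obtain ⟨a, b, ha, hb, hab, rfl⟩ := hqseg
  have ha0 : 0 < a := by
    refine lt_of_le_of_ne ha fun h => hz ?_
    rw [← h, zero_add] at hab
    rw [← h, hab] at hqK
    simpa using hqK
  set q := a • p + b • z
  -- The largest ball around `p'` touches the boundary at some `x` with `|x - q| ≤ 2|p' - q| < a r`.
  -- If the normal at `x` failed to separate `z`, then `⟨n, p⟩ + r ≤ ⟨n, x⟩` and `⟨n, z⟩ ≤ ⟨n, x⟩`
  -- would give `⟨n, x - q⟩ ≥ a r`.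
  obtain ⟨p', hp', hdist⟩ : ∃ p' ∈ interior K, dist q p' < a * r / 2 := by
    have hcl : q ∈ closure (interior K) := by
      rw [hK.convex.closure_interior_eq_closure_of_nonempty_interior hK.nonempty_interior]
      exact subset_closure hqK
    exact Metric.mem_closure_iff.1 hcl _ (by positivity)
  have hCcl : IsClosed (interior K)ᶜ := isOpen_interior.isClosed_compl
  obtain ⟨x, hxC, hx⟩ := hCcl.exists_infDist_eq_dist ⟨q, hqi⟩ p'
  have hρ : 0 < dist p' x := dist_pos.2 fun h => hxC (h ▸ hp')
  have hbsub : Metric.closedBall p' (dist p' x) ⊆ K := by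
    rw [← closure_ball p' hρ.ne', ← hx]
    exact closure_minimal (Metric.ball_infDist_compl_subset.trans interior_subset) hclosed
  have hxq : dist p' x ≤ dist p' q := hx ▸ Metric.infDist_le_dist_of_mem hqi
  have hxK : x ∈ K := hbsub (by simp [dist_comm])
  obtain ⟨n, hn, hle⟩ := hK.exists_normal hxC
  have hn' : n = (dist p' x)⁻¹ • (x - p') := by
    refine eq_of_closedBall_subset (K := K) (x := x) hρ ?_ hn ?_ hle
    · rw [norm_smul, norm_inv, Real.norm_of_nonneg hρ.le, dist_comm p' x, ← dist_eq_norm]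
      exact inv_mul_cancel₀ (by rw [dist_comm]; exact hρ.ne')
    · rw [smul_smul, mul_inv_cancel₀ hρ.ne', one_smul, sub_sub_cancel]
      exact hbsub
  refine ⟨x, n, ⟨hxK, hn, hle, dist p' x, hρ, ?_⟩, ?_⟩
  · rw [hn', smul_smul, mul_inv_cancel₀ hρ.ne', one_smul, sub_sub_cancel]
    exact hbsub
  · by_contra! hcon
    have h1 : inner ℝ n (p + r • n) ≤ inner ℝ n x := hle _ (hball (by
      rw [mem_closedBall_iff_norm, add_sub_cancel_left, norm_smul, hn, mul_one,
        Real.norm_of_nonneg hr.le]))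
    rw [inner_add_right, inner_smul_right, real_inner_self_eq_norm_sq, hn] at h1
    have h2 : inner ℝ n (x - q) ≤ dist x q := by
      refine (real_inner_le_norm _ _).trans ?_
      rw [hn, one_mul, dist_eq_norm]
    rw [inner_sub_right, inner_add_right, inner_smul_right, inner_smul_right] at h2
    have h3 : dist x q ≤ dist p' x + dist p' q := dist_triangle_left _ _ _
    rw [dist_comm q p'] at hdist
    have hb' : b = 1 - a := by linarith
    have h4 := mul_le_mul_of_nonneg_left h1 ha
    have h5 := mul_le_mul_of_nonneg_left hcon hb
    subst hb'
    nlinarith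

theorem IsConvexBody.isConvexPolytope_of_finite_regularNormals {d : ℕ}
    {K : Set (EuclideanSpace ℝ (Fin d))} (hK : IsConvexBody K)
    (hfin : {n | ∃ x, IsRegularNormal K x n}.Finite) : IsConvexPolytope K := by
  classical
  -- The offset is the maximum of `⟨n, ·⟩` on `K`, so it does not depend on the touching point; for
  -- other `n` it is immaterial.
  have hex : ∀ n : EuclideanSpace ℝ (Fin d), ∃ c : ℝ, ∀ x, IsRegularNormal K x n →
      c = inner ℝ n x := by
    intro n
    by_cases h : ∃ x, IsRegularNormal K x n
    · obtain ⟨x, hx⟩ := h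
      exact ⟨_, fun y hy => le_antisymm (hy.le x hx.mem) (hx.le y hy.mem)⟩
    · exact ⟨0, fun x hx => (h ⟨x, hx⟩).elim⟩
  choose c hc using hex
  have hKeq : K = {x | ∀ n ∈ {n | ∃ x, IsRegularNormal K x n}, inner ℝ n x ≤ c n} := by
    ext z
    constructor
    · rintro hz n ⟨x, hx⟩
      rw [hc n x hx]
      exact hx.le z hz
    · intro hz
      by_contra hzK
      obtain ⟨x, n, hx, hlt⟩ := hK.exists_isRegularNormal hzK
      exact absurd (hz n ⟨x, hx⟩) (by rw [hc n x hx]; exact not_le.2 hlt)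
  rw [hKeq]
  exact isConvexPolytope_of_finite_halfSpaces hfin c (hKeq ▸ hK.isCompact)

/-! ### Overlaps of translates -/

/-- If `x - K` and `x' - K` meet at `-u`, where `x` and `x'` have distinct regular normals, then
`u` is a difference of two interior points. -/
theorem IsConvexBody.exists_interior_add_mem {d : ℕ} {K : Set (EuclideanSpace ℝ (Fin d))}
    (hK : IsConvexBody K) {x x' n n' u : EuclideanSpace ℝ (Fin d)} (h : IsRegularNormal K x n)
    (h' : IsRegularNormal K x' n') (hne : n ≠ n') (hu : x + u ∈ K) (hu' : x' + u ∈ K) :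
    ∃ a ∈ interior K, a + u ∈ interior K := by
  by_contra! hcon
  have hshift : IsConvexBody ((fun y => u + y) ⁻¹' K) := by
    constructor
    · exact (Homeomorph.addLeft u).isCompact_preimage.2 hK.isCompact
    · exact hK.convex.translate_preimage_right u
    · obtain ⟨p, hp⟩ := hK.nonempty_interior
      refine ⟨p - u, ?_⟩
      have := (Homeomorph.addLeft u).preimage_interior K
      rw [Homeomorph.coe_addLeft] at this
      rw [← this]
      simpa using hp
  have hint : interior ((fun y => u + y) ⁻¹' K) = (fun y => u + y) ⁻¹' interior K :=
    ((Homeomorph.addLeft u).preimage_interior K).symm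
  have hdisj : Disjoint (interior ((fun y => u + y) ⁻¹' K)) (interior K) := by
    rw [Set.disjoint_left]
    intro a ha ha'
    rw [hint] at ha
    exact hcon a ha' (by rw [add_comm]; exact ha)
  -- A hyperplane separates `K - u` from `K`. Both `x` and `x'` belong to the two bodies, so they
  -- lie on it and share a normal.
  obtain ⟨f, s, hf1, hf2⟩ := geometric_hahn_banach_open_open hshift.convex.interior
    isOpen_interior hK.convex.interior isOpen_interior hdisj
  have hcl : ∀ {L : Set (EuclideanSpace ℝ (Fin d))}, IsConvexBody L → ∀ y ∈ L,
      y ∈ closure (interior L) := fun hL y hy => by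
    rw [hL.convex.closure_interior_eq_closure_of_nonempty_interior hL.nonempty_interior]
    exact subset_closure hy
  have hle1 : ∀ y, u + y ∈ K → f y ≤ s := fun y hy =>
    closure_minimal (t := {y | f y ≤ s}) (fun z hz => (hf1 z hz).le)
      (isClosed_le f.continuous continuous_const) (hcl hshift y hy)
  have hle2 : ∀ y ∈ K, s ≤ f y := fun y hy =>
    closure_minimal (t := {y | s ≤ f y}) (fun z hz => (hf2 z hz).le)
      (isClosed_le continuous_const f.continuous) (hcl hK y hy)
  set v := (InnerProductSpace.toDual ℝ (EuclideanSpace ℝ (Fin d))).symm f with hv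
  have hfv : ∀ y, f y = inner ℝ v y := fun y => by
    rw [hv, InnerProductSpace.toDual_symm_apply]
  have hv0 : v ≠ 0 := by
    intro h0
    obtain ⟨a, ha⟩ := hshift.nonempty_interior
    obtain ⟨b, hb⟩ := hK.nonempty_interior
    have h1 := hf1 a ha
    have h2 := hf2 b hb
    simp only [hfv, h0, inner_zero_left] at h1 h2
    exact lt_asymm h1 h2
  have hsupp : ∀ y, y ∈ K → u + y ∈ K → ∀ w ∈ K,
      inner ℝ (‖v‖⁻¹ • -v) w ≤ inner ℝ (‖v‖⁻¹ • -v) y := by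
    intro y hy huy w hw
    have : inner ℝ v y ≤ inner ℝ v w := by
      rw [← hfv, ← hfv]
      exact (hle1 y huy).trans (hle2 w hw)
    rw [inner_smul_left, inner_smul_left, inner_neg_left, inner_neg_left]
    exact mul_le_mul_of_nonneg_left (neg_le_neg this) (by simp)
  have hnorm : ‖‖v‖⁻¹ • -v‖ = 1 := by
    rw [smul_neg, norm_neg]
    exact norm_smul_inv_norm hv0
  rw [add_comm] at hu hu'
  exact hne ((h.unique hnorm (hsupp x h.mem hu)).symm.trans
    (h'.unique hnorm (hsupp x' h'.mem hu')))

-- Perturbation of the case `τ = 0`: the hypotheses are closed in `(τ, u)` and the conclusion is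
-- open in `u`, so compactness in `u` makes the range of `τ` uniform.
open Filter Topology in
theorem IsConvexBody.eventually_exists_interior_add_mem {d : ℕ}
    {K : Set (EuclideanSpace ℝ (Fin d))} (hK : IsConvexBody K)
    {x x' n n' : EuclideanSpace ℝ (Fin d)} (h : IsRegularNormal K x n)
    (h' : IsRegularNormal K x' n') (hne : n ≠ n') :
    ∀ᶠ τ : ℝ in 𝓝[>] 0, ∀ u, x + τ • n + u ∈ K → x' + τ • n' + u ∈ K →
      ∃ a ∈ interior K, a + u ∈ interior K := by
  obtain ⟨R, hR⟩ := hK.isCompact.isBounded.exists_norm_le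
  have hev : ∀ᶠ τ : ℝ in 𝓝 0, ∀ u ∈ Metric.closedBall (0 : EuclideanSpace ℝ (Fin d)) (2 * R + 1),
      (x + τ • n + u ∈ K → x' + τ • n' + u ∈ K → ∃ a ∈ interior K, a + u ∈ interior K) := by
    refine (isCompact_closedBall _ _).eventually_forall_of_forall_eventually fun u _ => ?_
    by_cases hu : x + u ∈ K
    · by_cases hu' : x' + u ∈ K
      · obtain ⟨a, ha, hau⟩ := hK.exists_interior_add_mem h h' hne hu hu'
        have hc : ContinuousAt (fun q : ℝ × EuclideanSpace ℝ (Fin d) => a + q.2) (0, u) := by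
          fun_prop
        filter_upwards [hc.preimage_mem_nhds (isOpen_interior.mem_nhds hau)] with q hq _ _
        exact ⟨a, ha, hq⟩
      · have hc : ContinuousAt (fun q : ℝ × EuclideanSpace ℝ (Fin d) => x' + q.1 • n' + q.2)
          (0, u) := by fun_prop
        filter_upwards [hc.preimage_mem_nhds (hK.isCompact.isClosed.isOpen_compl.mem_nhds
          (by simpa using hu'))] with q hq _ hq'
        exact (hq hq').elim
    · have hc : ContinuousAt (fun q : ℝ × EuclideanSpace ℝ (Fin d) => x + q.1 • n + q.2)
          (0, u) := by fun_prop
      filter_upwards [hc.preimage_mem_nhds (hK.isCompact.isClosed.isOpen_compl.mem_nhds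
          (by simpa using hu))] with q hq hq' _
      exact (hq hq').elim
  filter_upwards [hev.filter_mono nhdsWithin_le_nhds, Ioc_mem_nhdsGT one_pos] with τ hτ h01 u hu
  refine hτ u ?_ hu
  rw [mem_closedBall_zero_iff]
  calc ‖u‖ = ‖(x + τ • n + u) - x - τ • n‖ := by congr 1; abel
    _ ≤ ‖x + τ • n + u‖ + ‖x‖ + ‖τ • n‖ :=
      (norm_sub_le _ _).trans (by gcongr; exact norm_sub_le _ _)
    _ ≤ R + R + 1 := by
      gcongr
      · exact hR _ hu
      · exact hR _ h.mem
      · rw [norm_smul, h.norm_eq, mul_one, Real.norm_of_nonneg h01.1.le]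
        exact h01.2
    _ = 2 * R + 1 := by ring

/-! ### Exponentials and their inner products -/

theorem expFun_eq_exp_mul_I {d : ℕ} (ξ x : EuclideanSpace ℝ (Fin d)) :
    expFun ξ x = Complex.exp ((2 * Real.pi * inner ℝ ξ x : ℝ) * Complex.I) := by
  rw [expFun]
  congr 1
  push_cast
  ring

@[fun_prop]
theorem continuous_expFun {d : ℕ} (ξ : EuclideanSpace ℝ (Fin d)) : Continuous (expFun ξ) := by
  unfold expFun
  fun_prop

theorem norm_expFun {d : ℕ} (ξ x : EuclideanSpace ℝ (Fin d)) : ‖expFun ξ x‖ = 1 := by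
  rw [expFun_eq_exp_mul_I, Complex.norm_exp_ofReal_mul_I]

theorem expFun_add_left {d : ℕ} (ξ η x : EuclideanSpace ℝ (Fin d)) :
    expFun (ξ + η) x = expFun ξ x * expFun η x := by
  rw [expFun, expFun, expFun, ← Complex.exp_add, inner_add_left]
  congr 1
  push_cast
  ring

theorem expFun_add_right {d : ℕ} (ξ x y : EuclideanSpace ℝ (Fin d)) :
    expFun ξ (x + y) = expFun ξ x * expFun ξ y := by
  rw [expFun, expFun, expFun, ← Complex.exp_add, inner_add_right]
  congr 1
  push_cast
  ring

theorem conj_expFun {d : ℕ} (ξ x : EuclideanSpace ℝ (Fin d)) :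
    (starRingEnd ℂ) (expFun ξ x) = expFun (-ξ) x := by
  rw [expFun_eq_exp_mul_I, expFun_eq_exp_mul_I, ← Complex.exp_conj, inner_neg_left, map_mul,
    Complex.conj_ofReal, Complex.conj_I]
  congr 1
  push_cast
  ring

theorem expFun_neg_right {d : ℕ} (ξ x : EuclideanSpace ℝ (Fin d)) :
    expFun ξ (-x) = expFun (-ξ) x := by
  rw [expFun, expFun, inner_neg_left, inner_neg_right]

theorem expFun_zero {d : ℕ} (x : EuclideanSpace ℝ (Fin d)) : expFun 0 x = 1 := by
  simp [expFun]

theorem hasFDerivAt_expFun {d : ℕ} (ξ x : EuclideanSpace ℝ (Fin d)) :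
    HasFDerivAt (expFun ξ) (expFun ξ x • ((2 * Real.pi * Complex.I) •
      (Complex.ofRealCLM.comp (innerSL ℝ ξ)))) x := by
  have h : HasFDerivAt (fun x => ((inner ℝ ξ x : ℝ) : ℂ))
      (Complex.ofRealCLM.comp (innerSL ℝ ξ)) x :=
    (Complex.ofRealCLM.comp (innerSL ℝ ξ)).hasFDerivAt
  exact (h.const_mul (2 * Real.pi * Complex.I)).cexp

theorem inner_expLp_toLp {d : ℕ} {Ω : Set (EuclideanSpace ℝ (Fin d))}
    (hΩ : Bornology.IsBounded Ω) (ξ : EuclideanSpace ℝ (Fin d)) {f : EuclideanSpace ℝ (Fin d) → ℂ}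
    (hf : MemLp f 2 (volume.restrict Ω)) :
    inner ℂ (expLp hΩ ξ) (hf.toLp f) = ∫ x in Ω, expFun (-ξ) x * f x := by
  rw [L2.inner_def]
  refine integral_congr_ae ?_
  filter_upwards [(memLp_expFun hΩ ξ).coeFn_toLp, hf.coeFn_toLp] with x h1 h2
  rw [expLp, h1, h2, RCLike.inner_apply, conj_expFun, mul_comm]

theorem inner_expLp {d : ℕ} {Ω : Set (EuclideanSpace ℝ (Fin d))}
    (hΩ : Bornology.IsBounded Ω) (ξ η : EuclideanSpace ℝ (Fin d)) :
    inner ℂ (expLp hΩ ξ) (expLp hΩ η) = ∫ x in Ω, expFun (η - ξ) x := by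
  rw [expLp.eq_1 hΩ η, inner_expLp_toLp]
  refine integral_congr_ae (Filter.Eventually.of_forall fun x => ?_)
  rw [sub_eq_neg_add, expFun_add_left]

theorem norm_expLp_sq {d : ℕ} {Ω : Set (EuclideanSpace ℝ (Fin d))}
    (hΩ : Bornology.IsBounded Ω) (ξ : EuclideanSpace ℝ (Fin d)) :
    ‖expLp hΩ ξ‖ ^ 2 = volume.real Ω := by
  rw [← Complex.ofReal_inj]
  have := inner_self_eq_norm_sq_to_K (𝕜 := ℂ) (expLp hΩ ξ)
  rw [inner_expLp, sub_self] at this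
  simp only [expFun_zero, integral_const, measureReal_restrict_apply_univ] at this
  simpa using this.symm

theorem IsSpectrum.setIntegral_expFun {d : ℕ} {Ω : Set (EuclideanSpace ℝ (Fin d))}
    {hΩ : Bornology.IsBounded Ω} {Λ : Set (EuclideanSpace ℝ (Fin d))} (h : IsSpectrum hΩ Λ)
    (ξ η : Λ) : ∫ x in Ω, expFun (ξ - η : EuclideanSpace ℝ (Fin d)) x
      = if ξ = η then (volume.real Ω : ℂ) else 0 := by
  split_ifs with hξη
  · simp [hξη, expFun_zero]
  · rw [← inner_expLp hΩ]
    exact h.orthogonal _ η.2 _ ξ.2 fun h' => hξη (Subtype.ext h'.symm)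

/-! ### Separation and summability over the spectrum -/

/-- Frequencies of a spectrum are uniformly separated. -/
theorem IsSpectrum.exists_separation {d : ℕ} {Ω : Set (EuclideanSpace ℝ (Fin d))}
    {hΩ : Bornology.IsBounded Ω} {Λ : Set (EuclideanSpace ℝ (Fin d))} (h : IsSpectrum hΩ Λ)
    (hpos : 0 < volume Ω) : ∃ r > 0, ∀ ξ η : Λ, ξ ≠ η →
      r ≤ dist (ξ : EuclideanSpace ℝ (Fin d)) η := by
  obtain ⟨R, hR0, hR⟩ := hΩ.exists_pos_norm_le
  have hfin : volume Ω < ⊤ := hΩ.measure_lt_top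
  have hvol : 0 < volume.real Ω := ENNReal.toReal_pos hpos.ne' hfin.ne
  -- Closer frequencies would keep the phase on `Ω` within `1/2`, so the integral of `e - 1` would
  -- be at most `|Ω|/2` in norm; orthogonality makes that norm `|Ω|`.
  refine ⟨1 / (4 * Real.pi * R), by positivity, fun ξ η hne => ?_⟩
  by_contra! hlt
  have hbound : ∀ x ∈ Ω, ‖expFun (ξ - η : EuclideanSpace ℝ (Fin d)) x - 1‖ ≤ 1 / 2 := by
    intro x hx
    rw [expFun_eq_exp_mul_I, mul_comm _ Complex.I]
    refine (Real.norm_exp_I_mul_ofReal_sub_one_le).trans ?_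
    rw [Real.norm_eq_abs, abs_mul, abs_of_pos Real.two_pi_pos]
    have h1 := abs_real_inner_le_norm (ξ - η : EuclideanSpace ℝ (Fin d)) x
    rw [← dist_eq_norm] at h1
    calc 2 * Real.pi * |inner ℝ (ξ - η : EuclideanSpace ℝ (Fin d)) x|
        ≤ 2 * Real.pi * (1 / (4 * Real.pi * R) * R) := by
          gcongr
          exact h1.trans (by gcongr; exact hR x hx)
      _ = 1 / 2 := by field_simp; norm_num
  have hint := norm_setIntegral_le_of_norm_le_const hfin hbound
  have : IsFiniteMeasure (volume.restrict Ω) := ⟨by simpa using hfin⟩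
  have hI : Integrable (fun x => expFun (ξ - η : EuclideanSpace ℝ (Fin d)) x)
      (volume.restrict Ω) := by
    exact (memLp_expFun hΩ _).integrable (by norm_num)
  rw [integral_sub hI (integrable_const _),
    h.setIntegral_expFun, if_neg hne] at hint
  simp [abs_of_pos hvol] at hint
  linarith

theorem integrable_exp_neg_mul_norm {d : ℕ} {ε : ℝ} (hε : 0 < ε) :
    Integrable fun x : EuclideanSpace ℝ (Fin d) => Real.exp (-(ε * ‖x‖)) := by
  have hfr : (Module.finrank ℝ (EuclideanSpace ℝ (Fin d)) : ℝ) < ((d + 1 : ℕ) : ℝ) := by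
    rw [finrank_euclideanSpace_fin]
    exact_mod_cast d.lt_succ_self
  -- With this constant `c`, `c (1 + ‖x‖) ≤ exp (ε‖x‖ / (d + 1))`; the power `d + 1` compares with
  -- an integrable function.
  have hc : 0 < min 1 (ε / (d + 1)) := by positivity
  set c := min 1 (ε / (d + 1)) with hcdef
  refine ((integrable_one_add_norm hfr).const_mul ((c ^ (d + 1))⁻¹)).mono'
    (by fun_prop) (Filter.Eventually.of_forall fun x => ?_)
  rw [Real.norm_of_nonneg (Real.exp_pos _).le, Real.exp_neg, Real.rpow_neg (by positivity),
    Real.rpow_natCast, ← mul_inv, ← mul_pow]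
  gcongr
  calc (c * (1 + ‖x‖)) ^ (d + 1) ≤ (Real.exp (ε / (d + 1) * ‖x‖)) ^ (d + 1) := by
        gcongr
        have h1 : c ≤ 1 := min_le_left _ _
        have h2 : c * ‖x‖ ≤ ε / (d + 1) * ‖x‖ := by gcongr; exact min_le_right _ _
        have h3 := Real.add_one_le_exp (ε / (d + 1) * ‖x‖)
        linarith
    _ = Real.exp (ε * ‖x‖) := by
        rw [← Real.exp_nat_mul]
        congr 1
        push_cast
        field_simp

/-- The balls of radius `r / 2` around the frequencies are disjoint, and on each the exponential
varies by a factor of at most `exp (ε r / 2)` below its central value, so the sum is controlled by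
an integral. -/
theorem summable_exp_neg_mul_norm_of_separated {d : ℕ} {Λ : Set (EuclideanSpace ℝ (Fin d))} {r : ℝ}
    (hr : 0 < r) (hsep : ∀ ξ η : Λ, ξ ≠ η → r ≤ dist (ξ : EuclideanSpace ℝ (Fin d)) η)
    {ε : ℝ} (hε : 0 < ε) : Summable fun ξ : Λ => Real.exp (-(ε * ‖(ξ : EuclideanSpace ℝ (Fin d))‖)) := by
  set V := volume.real (Metric.ball (0 : EuclideanSpace ℝ (Fin d)) (r / 2)) with hV
  have hVpos : 0 < V := ENNReal.toReal_pos (Metric.measure_ball_pos _ _ (by positivity)).ne'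
    measure_ball_lt_top.ne
  have hI := integrable_exp_neg_mul_norm (d := d) hε
  refine summable_of_sum_le (c := V⁻¹ * (Real.exp (ε * (r / 2)) *
    ∫ x : EuclideanSpace ℝ (Fin d), Real.exp (-(ε * ‖x‖)))) (fun _ => (Real.exp_pos _).le)
    fun F => ?_
  rw [le_inv_mul_iff₀ hVpos, Finset.mul_sum, ← div_le_iff₀' (Real.exp_pos _), Finset.sum_div]
  have hle : ∀ ξ ∈ F, V * Real.exp (-(ε * ‖(ξ : EuclideanSpace ℝ (Fin d))‖)) /
      Real.exp (ε * (r / 2)) ≤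
      ∫ x in Metric.ball (ξ : EuclideanSpace ℝ (Fin d)) (r / 2), Real.exp (-(ε * ‖x‖)) := by
    intro ξ _
    have hVξ : volume.real (Metric.ball (ξ : EuclideanSpace ℝ (Fin d)) (r / 2)) = V := by
      rw [hV, measureReal_def, measureReal_def, Measure.addHaar_ball_center]
    rw [← hVξ, mul_div_assoc, ← Real.exp_sub, ← smul_eq_mul, ← setIntegral_const]
    refine setIntegral_mono_on (integrableOn_const measure_ball_lt_top.ne) hI.integrableOn
      measurableSet_ball fun x hx => Real.exp_le_exp.2 ?_
    have : ‖x‖ ≤ ‖(ξ : EuclideanSpace ℝ (Fin d))‖ + r / 2 := by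
      rw [mem_ball_iff_norm] at hx
      linarith [norm_sub_norm_le x (ξ : EuclideanSpace ℝ (Fin d))]
    nlinarith
  refine (Finset.sum_le_sum hle).trans ?_
  rw [← integral_biUnion_finset F (fun _ _ => measurableSet_ball) ?_ fun _ _ => hI.integrableOn]
  · exact setIntegral_le_integral hI (Filter.Eventually.of_forall fun x => (Real.exp_pos _).le)
  · intro ξ _ η _ hne
    exact Metric.ball_disjoint_ball (by linarith [hsep ξ η hne])

/-! ### Rayleigh quotients -/

open Filter Topology in
/-- A kernel on a set of polynomial growth, with constant row sums and bounded row second moments,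
has finitely supported test vectors on which its Rayleigh quotient almost attains the row sum. -/
theorem exists_rayleigh_gt {d : ℕ} {Λ : Set (EuclideanSpace ℝ (Fin d))} [Nonempty Λ]
    (hsum : ∀ ε : ℝ, 0 < ε →
      Summable fun ξ : Λ => Real.exp (-(ε * ‖(ξ : EuclideanSpace ℝ (Fin d))‖)))
    {k : Λ → Λ → ℝ} (hk : ∀ ξ η, 0 ≤ k ξ η) {c C c' : ℝ} (hc : ∀ ξ, HasSum (k ξ) c)
    (hC : ∀ ξ : Λ, HasSum (fun η : Λ => (1 + ‖(ξ - η : EuclideanSpace ℝ (Fin d))‖ ^ 2) * k ξ η) C)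
    (hc'0 : 0 ≤ c') (hc' : c' < c) :
    ∃ (F : Finset Λ) (w : Λ → ℝ), 0 < ∑ ξ ∈ F, w ξ ^ 2 ∧
      c' * ∑ ξ ∈ F, w ξ ^ 2 < ∑ ξ ∈ F, ∑ η ∈ F, w ξ * w η * k ξ η := by
  obtain ⟨ε, hε, hεc⟩ : ∃ ε : ℝ, 0 < ε ∧ c' < c - ε * C := by
    have hcont : Continuous fun ε : ℝ => c - ε * C := by fun_prop
    have hev : ∀ᶠ ε in 𝓝[>] (0 : ℝ), c' < c - ε * C :=
      ((hcont.tendsto 0).eventually_const_lt (by simpa using hc')).filter_mono nhdsWithin_le_nhds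
    obtain ⟨ε, h1, h2⟩ := (hev.and self_mem_nhdsWithin).exists
    exact ⟨ε, h2, h1⟩
  set w : Λ → ℝ := fun ξ => Real.exp (-(ε * ‖(ξ : EuclideanSpace ℝ (Fin d))‖)) with hw
  have hw0 : ∀ ξ, 0 < w ξ := fun ξ => Real.exp_pos _
  have hws : Summable fun ξ => w ξ ^ 2 := by
    refine (hsum (2 * ε) (by positivity)).congr fun ξ => ?_
    rw [hw, ← Real.exp_nat_mul]
    congr 1
    push_cast
    ring
  set S := ∑' ξ, w ξ ^ 2 with hS
  have hS0 : 0 < S := hws.tsum_pos (fun ξ => (sq_nonneg _)) (Classical.arbitrary Λ)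
    (pow_pos (hw0 _) 2)
  obtain ⟨F₁, hF₁⟩ : ∃ F₁ : Finset Λ, c' * S < ∑ ξ ∈ F₁, w ξ ^ 2 * (c - ε * C) :=
    ((hws.hasSum.mul_right (c - ε * C)).eventually_const_lt (by nlinarith)).exists
  have hrow : ∀ ξ, HasSum (fun η : Λ => w ξ ^ 2 *
      (k ξ η - ε * ((1 + ‖(ξ - η : EuclideanSpace ℝ (Fin d))‖ ^ 2) * k ξ η)))
      (w ξ ^ 2 * (c - ε * C)) := fun ξ =>
    ((hc ξ).sub ((hC ξ).mul_left ε)).mul_left _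
  -- The lower bound for a pair may be negative, so it is used only in the rows of `F₁`, whose row
  -- sums are nearly complete over `F`. The other rows of `F` contribute nonnegative terms.
  have hlim := tendsto_finsetSum F₁ fun ξ _ => hrow ξ
  obtain ⟨F, hF, hsub⟩ := ((hlim.eventually_const_lt hF₁).and (eventually_ge_atTop F₁)).exists
  have hsqle : ∑ ξ ∈ F, w ξ ^ 2 ≤ S := hws.sum_le_tsum _ fun ξ _ => sq_nonneg _
  have hFne : F₁.Nonempty := by
    rw [Finset.nonempty_iff_ne_empty]
    rintro rfl
    rw [Finset.sum_empty] at hF₁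
    exact absurd hF₁ (not_lt.2 (by positivity))
  have hterm : ∀ ξ η : Λ, w ξ ^ 2 *
      (k ξ η - ε * ((1 + ‖(ξ - η : EuclideanSpace ℝ (Fin d))‖ ^ 2) * k ξ η))
      ≤ w ξ * w η * k ξ η := by
    intro ξ η
    set s := ‖(ξ - η : EuclideanSpace ℝ (Fin d))‖ with hs
    -- The weights vary slowly: `w η ≥ w ξ exp (-εs)` and `exp (-εs) ≥ 1 - εs ≥ 1 - ε(1 + s²)`. The
    -- quadratic loss is what the second moment absorbs.
    have hwη : w ξ * (1 - ε * (1 + s ^ 2)) ≤ w η := by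
      calc w ξ * (1 - ε * (1 + s ^ 2)) ≤ w ξ * Real.exp (-(ε * s)) := by
            have h1 := Real.add_one_le_exp (-(ε * s))
            have h2 : s ≤ 1 + s ^ 2 := by nlinarith [sq_nonneg (s - 1)]
            refine mul_le_mul_of_nonneg_left ?_ (hw0 ξ).le
            nlinarith
        _ ≤ w η := by
            simp only [hw]
            rw [← Real.exp_add, Real.exp_le_exp]
            have : ‖(η : EuclideanSpace ℝ (Fin d))‖ ≤ ‖(ξ : EuclideanSpace ℝ (Fin d))‖ + s := by
              rw [hs, norm_sub_rev]
              linarith [norm_sub_norm_le (η : EuclideanSpace ℝ (Fin d)) ξ]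
            nlinarith
    calc _ = w ξ * (w ξ * (1 - ε * (1 + s ^ 2))) * k ξ η := by ring
      _ ≤ _ := by
        refine mul_le_mul_of_nonneg_right ?_ (hk ξ η)
        exact mul_le_mul_of_nonneg_left hwη (hw0 ξ).le
  refine ⟨F, w, Finset.sum_pos (fun ξ _ => pow_pos (hw0 ξ) 2) (hFne.mono hsub), ?_⟩
  calc c' * ∑ ξ ∈ F, w ξ ^ 2 ≤ c' * S := by gcongr
    _ < _ := hF
    _ ≤ ∑ ξ ∈ F₁, ∑ η ∈ F, w ξ * w η * k ξ η :=
      Finset.sum_le_sum fun ξ _ => Finset.sum_le_sum fun η _ => hterm ξ η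
    _ ≤ _ := by
      refine Finset.sum_le_sum_of_subset_of_nonneg hsub fun ξ _ _ => Finset.sum_nonneg fun η _ => ?_
      exact mul_nonneg (mul_nonneg (hw0 ξ).le (hw0 η).le) (hk ξ η)

/-! ### Parseval and second moments -/

/-- Parseval's identity for the orthogonal basis given by a spectrum. -/
theorem IsSpectrum.hasSum_norm_sq_setIntegral {d : ℕ} {Ω : Set (EuclideanSpace ℝ (Fin d))}
    {hΩ : Bornology.IsBounded Ω} {Λ : Set (EuclideanSpace ℝ (Fin d))} (h : IsSpectrum hΩ Λ)
    (hpos : 0 < volume Ω) {f : EuclideanSpace ℝ (Fin d) → ℂ}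
    (hf : MemLp f 2 (volume.restrict Ω)) :
    HasSum (fun ξ : Λ => ‖∫ x in Ω, expFun (-ξ : EuclideanSpace ℝ (Fin d)) x * f x‖ ^ 2)
      (volume.real Ω * ∫ x in Ω, ‖f x‖ ^ 2) := by
  have hvol : 0 < volume.real Ω := ENNReal.toReal_pos hpos.ne' hΩ.measure_lt_top.ne
  have hnorm : ∀ ξ, ‖expLp hΩ ξ‖ = √(volume.real Ω) := fun ξ => by
    rw [← norm_expLp_sq hΩ ξ, Real.sqrt_sq (norm_nonneg _)]
  have hsq : 0 < √(volume.real Ω) := Real.sqrt_pos.2 hvol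
  set c : ℂ := (((√(volume.real Ω))⁻¹ : ℝ) : ℂ) with hc
  have hc0 : c ≠ 0 := by
    rw [hc]
    exact_mod_cast (inv_pos.2 hsq).ne'
  have horth : Orthonormal ℂ fun ξ : Λ => c • expLp hΩ ξ := by
    constructor
    · intro ξ
      rw [norm_smul, hnorm, hc, Complex.norm_real, Real.norm_of_nonneg (by positivity)]
      exact inv_mul_cancel₀ hsq.ne'
    · intro ξ η hne
      rw [inner_smul_left, inner_smul_right,
        h.orthogonal ξ ξ.2 η η.2 fun h' => hne (Subtype.ext h')]
      simp
  have hspan : ⊤ ≤ (Submodule.span ℂ (Set.range fun ξ : Λ => c • expLp hΩ ξ)).topologicalClosure := by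
    rw [← h.complete]
    refine Submodule.topologicalClosure_mono (Submodule.span_le.2 ?_)
    rintro _ ⟨ξ, hξ, rfl⟩
    have := Submodule.smul_mem _ c⁻¹
      (Submodule.subset_span (R := ℂ) (Set.mem_range_self (f := fun ξ : Λ => c • expLp hΩ ξ) ⟨ξ, hξ⟩))
    simpa [smul_smul, inv_mul_cancel₀ hc0] using this
  have hsum := (HilbertBasis.mk horth hspan).hasSum_inner_mul_inner (hf.toLp f) (hf.toLp f)
  have hff : inner ℂ (hf.toLp f) (hf.toLp f) = ((∫ x in Ω, ‖f x‖ ^ 2 : ℝ) : ℂ) := by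
    rw [L2.inner_def, ← integral_complex_ofReal]
    refine integral_congr_ae ?_
    filter_upwards [hf.coeFn_toLp] with x hx
    rw [hx, inner_self_eq_norm_sq_to_K]
    simp
  have hterm : ∀ ξ : Λ, inner ℂ (hf.toLp f) (HilbertBasis.mk horth hspan ξ) *
      inner ℂ (HilbertBasis.mk horth hspan ξ) (hf.toLp f) =
      (((volume.real Ω)⁻¹ *
        ‖∫ x in Ω, expFun (-ξ : EuclideanSpace ℝ (Fin d)) x * f x‖ ^ 2 : ℝ) : ℂ) := by
    intro ξ
    rw [HilbertBasis.coe_mk, inner_smul_left, inner_smul_right, ← inner_conj_symm (hf.toLp f),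
      inner_expLp_toLp, hc, Complex.conj_ofReal]
    have h1 : (√(volume.real Ω))⁻¹ * (√(volume.real Ω))⁻¹ = (volume.real Ω)⁻¹ := by
      rw [← mul_inv, Real.mul_self_sqrt hvol.le]
    rw [mul_mul_mul_comm, Complex.conj_mul', ← Complex.ofReal_mul, h1]
    push_cast
    rfl
  simp only [hterm, hff, Complex.hasSum_ofReal] at hsum
  simpa [← mul_assoc, mul_inv_cancel₀ hvol.ne'] using hsum.mul_left (volume.real Ω)

/-- Parseval's identity for a test function modulated by a frequency. -/
theorem IsSpectrum.hasSum_norm_sq_integral {d : ℕ} {Ω : Set (EuclideanSpace ℝ (Fin d))}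
    {hΩ : Bornology.IsBounded Ω} {Λ : Set (EuclideanSpace ℝ (Fin d))} (h : IsSpectrum hΩ Λ)
    (hpos : 0 < volume Ω) {ψ : EuclideanSpace ℝ (Fin d) → ℂ} (hψ : Continuous ψ)
    (hcpt : HasCompactSupport ψ) (hsupp : Function.support ψ ⊆ Ω) (ξ : EuclideanSpace ℝ (Fin d)) :
    HasSum (fun η : Λ => ‖∫ x, expFun (ξ - η : EuclideanSpace ℝ (Fin d)) x * ψ x‖ ^ 2)
      (volume.real Ω * ∫ x, ‖ψ x‖ ^ 2) := by
  have hf : MemLp (fun x => expFun ξ x * ψ x) 2 (volume.restrict Ω) :=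
    (Continuous.memLp_of_hasCompactSupport (by fun_prop) hcpt.mul_left).restrict _
  have hsum := h.hasSum_norm_sq_setIntegral hpos hf
  convert hsum using 2
  · rename_i η
    rw [setIntegral_eq_integral_of_forall_compl_eq_zero]
    · congr 3
      ext x
      rw [sub_eq_neg_add, expFun_add_left, mul_assoc]
    · intro x hx
      rw [Function.notMem_support.1 fun hx' => hx (hsupp hx')]
      simp
  · rw [setIntegral_eq_integral_of_forall_compl_eq_zero]
    · simp [norm_expFun]
    · intro x hx
      rw [Function.notMem_support.1 fun hx' => hx (hsupp hx')]
      simp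

theorem integral_expFun_mul_fderiv {d : ℕ} {ψ : EuclideanSpace ℝ (Fin d) → ℂ}
    (hψ : ContDiff ℝ 1 ψ) (hcpt : HasCompactSupport ψ) (ξ v : EuclideanSpace ℝ (Fin d)) :
    ∫ x, expFun ξ x * fderiv ℝ ψ x v
      = -(2 * Real.pi * Complex.I * (inner ℝ ξ v : ℝ)) * ∫ x, expFun ξ x * ψ x := by
  have hd : ∀ x, fderiv ℝ (expFun ξ) x v
      = (2 * Real.pi * Complex.I * (inner ℝ ξ v : ℝ)) * expFun ξ x := fun x => by
    rw [(hasFDerivAt_expFun ξ x).fderiv]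
    simp
    ring
  have hcd : HasCompactSupport fun x => fderiv ℝ ψ x v := hcpt.fderiv_apply ℝ v
  have hcont : Continuous fun x => fderiv ℝ ψ x v :=
    (hψ.continuous_fderiv one_ne_zero).clm_apply continuous_const
  have hψc := hψ.continuous
  rw [integral_mul_fderiv_eq_neg_fderiv_mul_of_integrable]
  · simp only [hd, mul_assoc]
    rw [integral_const_mul, integral_const_mul, integral_const_mul, integral_const_mul]
    ring
  · simp only [hd]
    exact Continuous.integrable_of_hasCompactSupport (by fun_prop) hcpt.mul_left
  · exact Continuous.integrable_of_hasCompactSupport (by fun_prop) hcd.mul_left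
  · exact Continuous.integrable_of_hasCompactSupport (by fun_prop) hcpt.mul_left
  · exact fun x _ => (hasFDerivAt_expFun ξ x).differentiableAt
  · exact fun x _ => hψ.differentiable one_ne_zero x

/-- The weighted sum of squares of Fourier coefficients of a test function modulated by a frequency
does not depend on the frequency. -/
theorem IsSpectrum.exists_hasSum_weighted {d : ℕ} {Ω : Set (EuclideanSpace ℝ (Fin d))}
    {hΩ : Bornology.IsBounded Ω} {Λ : Set (EuclideanSpace ℝ (Fin d))} (h : IsSpectrum hΩ Λ)
    (hpos : 0 < volume Ω) {ψ : EuclideanSpace ℝ (Fin d) → ℂ} (hψ : ContDiff ℝ 1 ψ)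
    (hcpt : HasCompactSupport ψ) (hsupp : tsupport ψ ⊆ Ω) :
    ∃ C : ℝ, ∀ ξ : Λ, HasSum (fun η : Λ => (1 + ‖(ξ - η : EuclideanSpace ℝ (Fin d))‖ ^ 2) *
      ‖∫ x, expFun (ξ - η : EuclideanSpace ℝ (Fin d)) x * ψ x‖ ^ 2) C := by
  have hpar := h.hasSum_norm_sq_integral hpos hψ.continuous hcpt
    ((subset_tsupport ψ).trans hsupp)
  -- Partial derivatives are again supported in `Ω`; Parseval for them supplies the weight `‖ξ -
  -- η‖²`, one coordinate at a time.
  have hder : ∀ (i : Fin d) (ξ : EuclideanSpace ℝ (Fin d)), HasSum (fun η : Λ =>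
      ‖∫ x, expFun (ξ - η : EuclideanSpace ℝ (Fin d)) x *
        fderiv ℝ ψ x (EuclideanSpace.single i 1)‖ ^ 2)
      (volume.real Ω * ∫ x, ‖fderiv ℝ ψ x (EuclideanSpace.single i 1)‖ ^ 2) := fun i ξ => by
    refine h.hasSum_norm_sq_integral hpos
      ((hψ.continuous_fderiv one_ne_zero).clm_apply continuous_const)
      (hcpt.fderiv_apply ℝ _) ?_ ξ
    intro x hx
    refine hsupp (support_fderiv_subset ℝ fun h0 => hx ?_)
    simp [h0]
  refine ⟨volume.real Ω * (∫ x, ‖ψ x‖ ^ 2) + ((2 * Real.pi) ^ 2)⁻¹ *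
    ∑ i, volume.real Ω * ∫ x, ‖fderiv ℝ ψ x (EuclideanSpace.single i 1)‖ ^ 2, fun ξ => ?_⟩
  have hs := (hpar ξ).add ((hasSum_sum fun i (_ : i ∈ Finset.univ) => hder i ξ).mul_left
    ((2 * Real.pi) ^ 2)⁻¹)
  refine (congrArg (HasSum · _) (funext fun η => ?_)).mp hs
  simp only [integral_expFun_mul_fderiv hψ hcpt, norm_mul _ (integral _ _), mul_pow]
  rw [← Finset.sum_mul, EuclideanSpace.norm_sq_eq (ξ - η : EuclideanSpace ℝ (Fin d)), add_mul, one_mul,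
    ← mul_assoc, Finset.mul_sum]
  congr 2
  refine Finset.sum_congr rfl fun i _ => ?_
  have hi : inner ℝ (ξ - η : EuclideanSpace ℝ (Fin d)) (EuclideanSpace.single i 1)
      = (ξ - η : EuclideanSpace ℝ (Fin d)) i := by
    rw [EuclideanSpace.inner_single_right]
    simp
  have hnorm : ‖-(2 * Real.pi * Complex.I * ((ξ - η : EuclideanSpace ℝ (Fin d)) i : ℝ) : ℂ)‖ ^ 2
      = (2 * Real.pi) ^ 2 * ‖(ξ - η : EuclideanSpace ℝ (Fin d)) i‖ ^ 2 := by
    rw [norm_neg, norm_mul, Complex.norm_real, mul_pow]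
    simp [mul_pow]
  rw [hi, hnorm, ← mul_pow, inv_mul_cancel_left₀ (by positivity)]

/-! ### Squares of trigonometric sums -/

theorem integral_finsetSum_finsetSum {α ι κ : Type*} [MeasurableSpace α] {μ : Measure α}
    (s : Finset ι) (t : Finset κ) {f : ι → κ → α → ℂ} (hf : ∀ i j, Integrable (f i j) μ) :
    ∫ x, ∑ i ∈ s, ∑ j ∈ t, f i j x ∂μ = ∑ i ∈ s, ∑ j ∈ t, ∫ x, f i j x ∂μ := by
  rw [integral_finsetSum _ fun i _ => integrable_finsetSum _ fun j _ => hf i j]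
  exact Finset.sum_congr rfl fun i _ => integral_finsetSum _ fun j _ => hf i j

theorem ofReal_norm_sq_sum_expFun {d : ℕ} {ι : Type*} (F : Finset ι) (w : ι → ℝ)
    (v : ι → EuclideanSpace ℝ (Fin d)) (x : EuclideanSpace ℝ (Fin d)) :
    ((‖∑ i ∈ F, w i * expFun (v i) x‖ ^ 2 : ℝ) : ℂ)
      = ∑ i ∈ F, ∑ j ∈ F, (w i * w j : ℝ) * expFun (v i - v j) x := by
  rw [Complex.ofReal_pow, ← Complex.mul_conj', map_sum, Finset.sum_mul_sum]
  refine Finset.sum_congr rfl fun i _ => Finset.sum_congr rfl fun j _ => ?_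
  rw [map_mul, conj_expFun, Complex.conj_ofReal, sub_eq_add_neg, expFun_add_left]
  push_cast
  ring

/-- Translation multiplies each term of the expanded square by a phase, so the off-diagonal terms
still vanish by orthogonality, and on the diagonal the phase is `1`. -/
theorem IsSpectrum.setIntegral_norm_sq_sum {d : ℕ} {Ω : Set (EuclideanSpace ℝ (Fin d))}
    {hΩ : Bornology.IsBounded Ω} {Λ : Set (EuclideanSpace ℝ (Fin d))} (h : IsSpectrum hΩ Λ)
    (F : Finset Λ) (w : Λ → ℝ) (t : EuclideanSpace ℝ (Fin d)) :
    ∫ x in {u | t + u ∈ Ω}, ‖∑ ξ ∈ F, w ξ * expFun (ξ : EuclideanSpace ℝ (Fin d)) x‖ ^ 2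
      = volume.real Ω * ∑ ξ ∈ F, w ξ ^ 2 := by
  classical
  have hfin : IsFiniteMeasure (volume.restrict Ω) := ⟨by simpa using hΩ.measure_lt_top⟩
  set G : EuclideanSpace ℝ (Fin d) → ℝ :=
    fun x => ‖∑ ξ ∈ F, w ξ * expFun (ξ : EuclideanSpace ℝ (Fin d)) x‖ ^ 2 with hG
  have htr := (measurePreserving_add_left volume t).setIntegral_preimage_emb
    (measurableEmbedding_addLeft t) (fun y => G (y + -t)) Ω
  simp only [add_neg_cancel_comm] at htr
  refine htr.trans ?_
  rw [← Complex.ofReal_inj, ← integral_complex_ofReal]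
  simp only [hG, ofReal_norm_sq_sum_expFun]
  simp only [expFun_add_right]
  have hI : ∀ ξ η : Λ, Integrable (fun x => ((w ξ * w η : ℝ) : ℂ) *
      (expFun (ξ - η : EuclideanSpace ℝ (Fin d)) x * expFun (ξ - η : EuclideanSpace ℝ (Fin d)) (-t)))
      (volume.restrict Ω) := fun ξ η =>
    (((memLp_expFun hΩ _).integrable (by norm_num)).mul_const _).const_mul _
  rw [integral_finsetSum_finsetSum _ _ hI]
  simp only [integral_const_mul, integral_mul_const,
    h.setIntegral_expFun]
  rw [Complex.ofReal_mul, Complex.ofReal_sum, Finset.mul_sum]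
  refine Finset.sum_congr rfl fun ξ hξ => ?_
  rw [Finset.sum_eq_single ξ (fun η _ hne => by simp [hne.symm]) fun hn => (hn hξ).elim]
  simp [expFun_zero]
  ring

/-- In the expanded square each exponential of `x - y` splits into a factor in `x` and a conjugate
factor in `y`. This turns the Rayleigh form into an integral of `G`. -/
theorem integral_norm_sq_sum_mul_mul {d : ℕ} {ι : Type*} (F : Finset ι) (w : ι → ℝ)
    (v : ι → EuclideanSpace ℝ (Fin d)) {ψ : EuclideanSpace ℝ (Fin d) → ℝ} (hψ : Continuous ψ)
    (hcpt : HasCompactSupport ψ) :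
    ∫ x, ∫ y, ‖∑ i ∈ F, w i * expFun (v i) (x - y)‖ ^ 2 * ψ x * ψ y
      = ∑ i ∈ F, ∑ j ∈ F, w i * w j * ‖∫ x, expFun (v i - v j) x * ψ x‖ ^ 2 := by
  have hcpt' : HasCompactSupport fun x => (ψ x : ℂ) := hcpt.comp_left Complex.ofReal_zero
  have hIe : ∀ ξ, Integrable fun x => expFun ξ x * (ψ x : ℂ) := fun ξ =>
    Continuous.integrable_of_hasCompactSupport (by fun_prop) hcpt'.mul_left
  have hconj : ∀ ξ, ∫ y, expFun ξ (-y) * (ψ y : ℂ)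
      = (starRingEnd ℂ) (∫ y, expFun ξ y * (ψ y : ℂ)) := fun ξ => by
    rw [← integral_conj]
    congr 1
    ext y
    rw [map_mul, conj_expFun, expFun_neg_right, Complex.conj_ofReal]
  have hIe' : ∀ ξ, Integrable fun x => expFun ξ (-x) * (ψ x : ℂ) := fun ξ => by
    simp only [expFun_neg_right]
    exact hIe _
  have hinner : ∀ x, ((∫ y, ‖∑ i ∈ F, w i * expFun (v i) (x - y)‖ ^ 2 * ψ x * ψ y : ℝ) : ℂ)
      = ∑ i ∈ F, ∑ j ∈ F, ((w i * w j : ℝ) : ℂ) * (expFun (v i - v j) x * (ψ x : ℂ)) *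
        (starRingEnd ℂ) (∫ y, expFun (v i - v j) y * (ψ y : ℂ)) := by
    intro x
    rw [← integral_complex_ofReal]
    have hexp : ∀ y, ((‖∑ i ∈ F, w i * expFun (v i) (x - y)‖ ^ 2 * ψ x * ψ y : ℝ) : ℂ)
        = ∑ i ∈ F, ∑ j ∈ F, ((w i * w j : ℝ) : ℂ) * (expFun (v i - v j) x * (ψ x : ℂ)) *
          (expFun (v i - v j) (-y) * (ψ y : ℂ)) := fun y => by
      rw [Complex.ofReal_mul, Complex.ofReal_mul, ofReal_norm_sq_sum_expFun, Finset.sum_mul,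
        Finset.sum_mul]
      refine Finset.sum_congr rfl fun i _ => ?_
      rw [Finset.sum_mul, Finset.sum_mul]
      refine Finset.sum_congr rfl fun j _ => ?_
      rw [sub_eq_add_neg x y, expFun_add_right]
      ring
    simp only [hexp]
    rw [integral_finsetSum_finsetSum _ _ fun i j => (hIe' _).const_mul _]
    simp only [integral_const_mul, hconj]
  rw [← Complex.ofReal_inj, ← integral_complex_ofReal]
  simp only [hinner]
  rw [integral_finsetSum_finsetSum _ _ fun i j => ((hIe _).const_mul _).mul_const _]
  rw [Complex.ofReal_sum]
  refine Finset.sum_congr rfl fun i _ => ?_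
  rw [Complex.ofReal_sum]
  refine Finset.sum_congr rfl fun j _ => ?_
  rw [integral_mul_const, integral_const_mul, mul_assoc, Complex.mul_conj',
    Complex.ofReal_mul _ (_ ^ 2), Complex.ofReal_pow]

/-- The autocorrelation of `ψ` is at most `∫ψ²` and vanishes outside the ball of radius `δ`. -/
theorem integral_sub_mul_mul_le {d : ℕ} {G ψ : EuclideanSpace ℝ (Fin d) → ℝ} (hG : Continuous G)
    (hG0 : ∀ x, 0 ≤ G x) (hψ : Continuous ψ) (hψ0 : ∀ x, 0 ≤ ψ x) {p : EuclideanSpace ℝ (Fin d)}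
    {δ : ℝ} (hsupp : ∀ x, ψ x ≠ 0 → x ∈ Metric.ball p (δ / 2)) :
    ∫ x, ∫ y, G (x - y) * ψ x * ψ y ≤ (∫ x, ψ x ^ 2) * ∫ z in Metric.ball 0 δ, G z := by
  have hcpt : HasCompactSupport ψ :=
    HasCompactSupport.of_support_subset_isCompact (isCompact_closedBall p (δ / 2))
      fun x hx => Metric.ball_subset_closedBall (hsupp x hx)
  have hdiff : ∀ x z, ψ x ≠ 0 → ψ (x - z) ≠ 0 → z ∈ Metric.ball (0 : EuclideanSpace ℝ (Fin d)) δ := by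
    intro x z h1 h2
    rw [mem_ball_zero_iff]
    have := dist_triangle_right x (x - z) p
    rw [dist_eq_norm x (x - z), sub_sub_cancel] at this
    linarith [Metric.mem_ball.1 (hsupp x h1), Metric.mem_ball.1 (hsupp _ h2)]
  have hsq : Integrable fun x => ψ x ^ 2 :=
    Continuous.integrable_of_hasCompactSupport (by fun_prop)
      (hcpt.comp_left (g := fun s : ℝ => s ^ 2) (by simp))
  have hshift : ∀ x, ∫ y, G (x - y) * ψ x * ψ y = ∫ z, G z * ψ x * ψ (x - z) := fun x => by
    rw [← integral_sub_left_eq_self (fun z => G z * ψ x * ψ (x - z)) volume x]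
    simp only [sub_sub_cancel]
  have hswap : ∫ x, ∫ z, G z * ψ x * ψ (x - z) = ∫ z, ∫ x, G z * ψ x * ψ (x - z) := by
    refine integral_integral_swap_of_hasCompactSupport (by fun_prop) ?_
    refine HasCompactSupport.of_support_subset_isCompact
      ((isCompact_closedBall p (δ / 2)).prod (isCompact_closedBall 0 δ)) ?_
    rintro ⟨x, z⟩ hxz
    have h1 : ψ x ≠ 0 := fun h0 => hxz (by simp [h0])
    have h2 : ψ (x - z) ≠ 0 := fun h0 => hxz (by simp [h0])
    exact ⟨Metric.ball_subset_closedBall (hsupp x h1),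
      Metric.ball_subset_closedBall (hdiff x z h1 h2)⟩
  simp only [hshift]
  rw [hswap, ← integral_const_mul, ← integral_indicator measurableSet_ball]
  refine integral_mono_of_nonneg (Filter.Eventually.of_forall fun z => integral_nonneg fun x =>
    mul_nonneg (mul_nonneg (hG0 z) (hψ0 x)) (hψ0 _)) ?_ (Filter.Eventually.of_forall fun z => ?_)
  · rw [integrable_indicator_iff measurableSet_ball]
    exact ((hG.continuousOn.integrableOn_compact (isCompact_closedBall 0 δ)).mono_set
      Metric.ball_subset_closedBall).const_mul _
  · simp only [mul_assoc]
    rw [integral_const_mul]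
    by_cases hz : z ∈ Metric.ball (0 : EuclideanSpace ℝ (Fin d)) δ
    · rw [Set.indicator_of_mem hz, mul_comm]
      refine mul_le_mul_of_nonneg_right ?_ (hG0 z)
      have hsq' : Integrable fun x => ψ (x - z) ^ 2 := hsq.comp_sub_right z
      calc ∫ x, ψ x * ψ (x - z) ≤ ∫ x, (ψ x ^ 2 + ψ (x - z) ^ 2) / 2 := by
            refine integral_mono_of_nonneg (Filter.Eventually.of_forall fun x =>
              mul_nonneg (hψ0 _) (hψ0 _)) ((hsq.add hsq').div_const 2)
              (Filter.Eventually.of_forall fun x => ?_)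
            have := two_mul_le_add_sq (ψ x) (ψ (x - z))
            dsimp only
            linarith
        _ = ∫ x, ψ x ^ 2 := by
            rw [integral_div, integral_add hsq hsq',
              integral_sub_right_eq_self (fun x => ψ x ^ 2) z]
            ring
    · rw [Set.indicator_of_notMem hz]
      have : ∀ x, ψ x * ψ (x - z) = 0 := by
        intro x
        by_contra hne
        rw [mul_eq_zero, not_or] at hne
        exact hz (hdiff x z hne.1 hne.2)
      simp [this]

/-! ### Concentrated measures -/

/-- A spectrum yields measures which give mass one to all translates of `-Ω` and are concentrated
near the origin inside such a translate. -/
theorem IsSpectrum.exists_measure {d : ℕ} {Ω : Set (EuclideanSpace ℝ (Fin d))}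
    {hΩ : Bornology.IsBounded Ω} {Λ : Set (EuclideanSpace ℝ (Fin d))} (h : IsSpectrum hΩ Λ)
    (hmeas : MeasurableSet Ω) (hint : (interior Ω).Nonempty) {δ η : ℝ} (hδ : 0 < δ) (hη : 0 < η) :
    ∃ ν : Measure (EuclideanSpace ℝ (Fin d)), (∀ t, ν {u | t + u ∈ Ω} = 1) ∧
      1 ≤ ν (Metric.ball 0 δ) + ENNReal.ofReal η := by
  have hpos : 0 < volume Ω :=
    (isOpen_interior.measure_pos volume hint).trans_le (measure_mono interior_subset)
  have hvol : 0 < volume.real Ω := ENNReal.toReal_pos hpos.ne' hΩ.measure_lt_top.ne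
  obtain ⟨p, hp⟩ := hint
  obtain ⟨ρ, hρ, hρΩ⟩ := Metric.nhds_basis_closedBall.mem_iff.1 (mem_interior_iff_mem_nhds.1 hp)
  have hr : 0 < min ρ (δ / 2) := by positivity
  -- Radius `ρ` keeps the bump in `Ω`; `δ / 2` keeps differences of its support points in the ball
  -- of radius `δ`.
  let b : ContDiffBump p := ⟨min ρ (δ / 2) / 2, min ρ (δ / 2), half_pos hr, half_lt_self hr⟩
  have hb1 : ContDiff ℝ 1 b := b.contDiff
  have hb2 : ContDiff ℝ 1 fun x => (b x : ℂ) := Complex.ofRealCLM.contDiff.comp hb1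
  have hbc : HasCompactSupport fun x => (b x : ℂ) :=
    b.hasCompactSupport.comp_left Complex.ofReal_zero
  have hbsupp : tsupport (fun x => (b x : ℂ)) ⊆ Ω := by
    refine (closure_mono fun x hx => ?_ : _ ⊆ tsupport b).trans ?_
    · exact fun h0 => hx (by simp [h0])
    · rw [← tsupport, b.tsupport_eq]
      exact (Metric.closedBall_subset_closedBall (min_le_left _ _)).trans hρΩ
  have hbsupp' : ∀ x, b x ≠ 0 → x ∈ Metric.ball p (δ / 2) := by
    intro x hx
    have hx' : x ∈ Function.support b := hx
    rw [b.support_eq] at hx'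
    exact Metric.ball_subset_ball (min_le_right _ _) hx'
  set I := ∫ x, b x ^ 2 with hI
  have hI0 : 0 < I := by
    have hcont : Continuous fun x => b x ^ 2 := by
      have := b.continuous
      fun_prop
    refine hcont.integral_pos_of_hasCompactSupport_nonneg_nonzero
      (b.hasCompactSupport.comp_left (g := fun s : ℝ => s ^ 2) (by simp)) (fun x => sq_nonneg _)
      (x := p) ?_
    rw [b.one_of_mem_closedBall (Metric.mem_closedBall_self b.rIn_pos.le)]
    norm_num
  have hpar := h.hasSum_norm_sq_integral hpos hb2.continuous hbc ((subset_tsupport _).trans hbsupp)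
  have hII : ∫ x, ‖(b x : ℂ)‖ ^ 2 = I := by simp [hI]
  rw [hII] at hpar
  obtain ⟨C, hC⟩ := h.exists_hasSum_weighted hpos hb2 hbc hbsupp
  obtain ⟨r, hr, hsep⟩ := h.exists_separation hpos
  have hne : Nonempty Λ := by
    by_contra hempty
    rw [not_nonempty_iff] at hempty
    have := (hpar 0).unique hasSum_empty
    exact (mul_pos hvol hI0).ne' this
  -- The minimum with `1 / 2` keeps the target nonnegative when `η` is large.
  obtain ⟨F, w, hw, hFw⟩ := exists_rayleigh_gt
    (fun ε hε => summable_exp_neg_mul_norm_of_separated hr hsep hε)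
    (fun ξ η => sq_nonneg _) (fun ξ : Λ => hpar ξ) hC (c' := (1 - min η (1 / 2)) *
      (volume.real Ω * I))
    (mul_nonneg (by linarith [min_le_right η (1 / 2)]) (by positivity))
    (by
      have : 0 < min η (1 / 2) := by positivity
      have : 0 < volume.real Ω * I := by positivity
      nlinarith)
  set S := ∑ ξ ∈ F, w ξ ^ 2 with hS
  set G : EuclideanSpace ℝ (Fin d) → ℝ :=
    fun x => ‖∑ ξ ∈ F, w ξ * expFun (ξ : EuclideanSpace ℝ (Fin d)) x‖ ^ 2 with hG
  have hGc : Continuous G := by fun_prop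
  have hG0 : ∀ x, 0 ≤ G x := fun x => sq_nonneg _
  have hGI : ∀ s : Set (EuclideanSpace ℝ (Fin d)), Bornology.IsBounded s → IntegrableOn G s := by
    intro s hs
    exact (hGc.continuousOn.integrableOn_compact hs.isCompact_closure).mono_set subset_closure
  have hupper := integral_sub_mul_mul_le hGc hG0 b.continuous (fun x => b.nonneg) hbsupp'
  rw [integral_norm_sq_sum_mul_mul F w (fun ξ : Λ => (ξ : EuclideanSpace ℝ (Fin d))) b.continuous
    b.hasCompactSupport] at hupper
  have hVS : 0 < volume.real Ω * S := by positivity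
  have hν : ∀ s : Set (EuclideanSpace ℝ (Fin d)), Bornology.IsBounded s → MeasurableSet s →
      volume.withDensity (fun x => ENNReal.ofReal (G x / (volume.real Ω * S))) s
        = ENNReal.ofReal ((∫ x in s, G x) / (volume.real Ω * S)) := by
    intro s hs hsm
    rw [withDensity_apply _ hsm, ← integral_div, ofReal_integral_eq_lintegral_ofReal
      ((hGI s hs).div_const _) (Filter.Eventually.of_forall fun x => div_nonneg (hG0 x) hVS.le)]
  refine ⟨volume.withDensity fun x => ENNReal.ofReal (G x / (volume.real Ω * S)), fun t => ?_, ?_⟩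
  · rw [hν, h.setIntegral_norm_sq_sum F w t, div_self hVS.ne', ENNReal.ofReal_one]
    · refine (hΩ.vadd (-t)).subset fun u hu => ?_
      exact ⟨t + u, hu, by simp⟩
    · exact measurable_const_add t hmeas
  · rw [hν _ Metric.isBounded_ball measurableSet_ball, ← ENNReal.ofReal_add
      (div_nonneg (integral_nonneg hG0) hVS.le) hη.le, ENNReal.one_le_ofReal]
    have h1 : (1 - min η (1 / 2)) * (volume.real Ω * S) < ∫ z in Metric.ball 0 δ, G z := by
      have := hFw.trans_le hupper
      rw [← hI] at this
      refine lt_of_mul_lt_mul_left (a := I) ?_ hI0.le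
      linarith
    have h2 := (lt_div_iff₀ hVS).2 h1
    linarith [min_le_left η (1 / 2)]

/-! ### Counting regular normals -/

open Filter Topology in
/-- If measures which give mass one to every translate of `-K` can be concentrated near the origin
inside such a translate, then `K` has only finitely many regular normals. -/
theorem IsConvexBody.finite_regularNormals {d : ℕ} {K : Set (EuclideanSpace ℝ (Fin d))}
    (hK : IsConvexBody K)
    (hν : ∀ δ η : ℝ, 0 < δ → 0 < η → ∃ ν : Measure (EuclideanSpace ℝ (Fin d)),
      (∀ t, ν {u | t + u ∈ K} = 1) ∧ 1 ≤ ν (Metric.ball 0 δ) + ENNReal.ofReal η) :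
    {n | ∃ x, IsRegularNormal K x n}.Finite := by
  classical
  by_contra hinf
  obtain ⟨R, hR⟩ := hK.isCompact.isBounded.exists_norm_le
  have hopen : ∀ a : EuclideanSpace ℝ (Fin d), IsOpen {u | a + u ∈ interior K} := fun a =>
    isOpen_interior.preimage (continuous_const.add continuous_id)
  have hclosed : ∀ a : EuclideanSpace ℝ (Fin d), IsClosed {u | a + u ∈ K} := fun a =>
    hK.isCompact.isClosed.preimage (continuous_const.add continuous_id)
  -- a uniform bound for the mass of a large ball
  obtain ⟨A, hA⟩ : ∃ A : Finset (EuclideanSpace ℝ (Fin d)),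
      Metric.closedBall (0 : EuclideanSpace ℝ (Fin d)) (2 * R + 1) ⊆
        ⋃ a ∈ A, {u | a + u ∈ interior K} := by
    refine (isCompact_closedBall _ _).elim_finite_subcover _ hopen fun u _ => ?_
    obtain ⟨p, hp⟩ := hK.nonempty_interior
    exact Set.mem_iUnion.2 ⟨p - u, by simpa using hp⟩
  obtain ⟨N, hN, hcard⟩ := Set.Infinite.exists_subset_card_eq hinf (A.card + 1)
  have hreg : ∀ n : EuclideanSpace ℝ (Fin d), ∃ x, n ∈ N → IsRegularNormal K x n := fun n => by
    by_cases hn : n ∈ N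
    · obtain ⟨x, hx⟩ := hN hn
      exact ⟨x, fun _ => hx⟩
    · exact ⟨0, fun h => (hn h).elim⟩
  choose x hx using hreg
  obtain ⟨τ, hτ, hτ0, hτ1⟩ : ∃ τ : ℝ, (∀ n ∈ N, ∀ n' ∈ N, n ≠ n' →
      ∀ u, x n + τ • n + u ∈ K → x n' + τ • n' + u ∈ K →
        ∃ a ∈ interior K, a + u ∈ interior K) ∧ 0 < τ ∧ τ ≤ 1 := by
    have hev : ∀ᶠ τ : ℝ in 𝓝[>] 0, ∀ n ∈ N, ∀ n' ∈ N, n ≠ n' →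
      ∀ u, x n + τ • n + u ∈ K → x n' + τ • n' + u ∈ K →
        ∃ a ∈ interior K, a + u ∈ interior K := by
      refine (Finset.eventually_all N).2 fun n hn => (Finset.eventually_all N).2 fun n' hn' => ?_
      by_cases hne : n = n'
      · exact Eventually.of_forall fun _ h => (h hne).elim
      · exact (hK.eventually_exists_interior_add_mem (hx n hn) (hx n' hn') hne).mono
          fun _ h _ => h
    obtain ⟨τ, h, h'⟩ := (hev.and (Ioc_mem_nhdsGT one_pos)).exists
    exact ⟨τ, h, h'.1, h'.2⟩
  set C : EuclideanSpace ℝ (Fin d) → Set (EuclideanSpace ℝ (Fin d)) :=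
    fun n => {u | x n + τ • n + u ∈ K} with hC
  have hCbound : ∀ n ∈ N, C n ⊆ Metric.closedBall 0 (2 * R + 1) := by
    intro n hn u hu
    rw [mem_closedBall_zero_iff]
    calc ‖u‖ = ‖(x n + τ • n + u) - x n - τ • n‖ := by congr 1; abel
      _ ≤ ‖x n + τ • n + u‖ + ‖x n‖ + ‖τ • n‖ :=
        (norm_sub_le _ _).trans (by gcongr; exact norm_sub_le _ _)
      _ ≤ R + R + 1 := by
        gcongr
        · exact hR _ hu
        · exact hR _ (hx n hn).mem
        · rw [norm_smul, (hx n hn).norm_eq, mul_one, Real.norm_of_nonneg hτ0.le]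
          exact hτ1
      _ = 2 * R + 1 := by ring
  -- On `C n` the supporting inequality at `x n` gives `⟨n, u⟩ ≤ -τ`.
  have hCball : ∀ n ∈ N, ∀ u ∈ C n, u ∉ Metric.ball (0 : EuclideanSpace ℝ (Fin d)) τ := by
    intro n hn u hu hub
    have h1 := (hx n hn).le _ hu
    rw [inner_add_right, inner_add_right, inner_smul_right, real_inner_self_eq_norm_sq,
      (hx n hn).norm_eq] at h1
    have h2 := abs_le.1 (abs_real_inner_le_norm n u)
    rw [(hx n hn).norm_eq, one_mul] at h2
    rw [mem_ball_zero_iff] at hub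
    linarith [h2.1]
  set P : Set (EuclideanSpace ℝ (Fin d)) := ⋃ q ∈ N.offDiag, C q.1 ∩ C q.2 with hP
  have hPcomp : IsCompact P := by
    refine N.offDiag.isCompact_biUnion fun q hq => ?_
    exact (isCompact_closedBall _ _).of_isClosed_subset ((hclosed _).inter (hclosed _))
      (Set.inter_subset_left.trans (hCbound _ (Finset.mem_offDiag.1 hq).1))
  obtain ⟨B, hB⟩ : ∃ B : Finset (interior K), P ⊆ ⋃ b ∈ B, {u | b.1 + u ∈ interior K} := by
    refine hPcomp.elim_finite_subcover _ (fun b => hopen b.1) fun u hu => ?_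
    obtain ⟨q, hq, h1, h2⟩ := Set.mem_iUnion₂.1 hu
    rw [Finset.mem_offDiag] at hq
    obtain ⟨a, ha, hau⟩ := hτ _ hq.1 _ hq.2.1 hq.2.2 u h1 h2
    exact Set.mem_iUnion.2 ⟨⟨a, ha⟩, hau⟩
  obtain ⟨δ, hδB, hδ0, hδτ⟩ : ∃ δ : ℝ, (∀ b ∈ B, Metric.ball b.1 δ ⊆ K) ∧ 0 < δ ∧ δ ≤ τ := by
    have hev : ∀ᶠ δ : ℝ in 𝓝[>] 0, ∀ b ∈ B, Metric.ball b.1 δ ⊆ K := by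
      refine (Finset.eventually_all B).2 fun b _ => ?_
      obtain ⟨ε, hε, hεK⟩ := Metric.nhds_basis_ball.mem_iff.1 (mem_interior_iff_mem_nhds.1 b.2)
      filter_upwards [Ioc_mem_nhdsGT hε] with δ hδ
      exact (Metric.ball_subset_ball hδ.2).trans hεK
    obtain ⟨δ, h, h'⟩ := (hev.and (Ioc_mem_nhdsGT hτ0)).exists
    exact ⟨δ, h, h'.1, h'.2⟩
  set k : ℕ := A.card + 1 with hk
  -- Chosen after `A`, `τ` and `B`, which do not involve the measure: the `k` sets lose at most
  -- `B.card * η` each, in total at most `1 / 2`, less than the excess `k - A.card = 1`.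
  set η : ℝ := 1 / (2 * k * (B.card + 1)) with hη
  have hη0 : 0 < η := by positivity
  obtain ⟨ν, hν1, hνη⟩ := hν δ η hδ0 hη0
  set D := Metric.ball (0 : EuclideanSpace ℝ (Fin d)) δ with hD
  -- Each translate of `K` by an element of `B` contains `D` and has mass one, so at most `η` of it
  -- lies outside `D`.
  have hPmass : ν (P \ D) ≤ B.card * ENNReal.ofReal η := by
    have hsub : P \ D ⊆ ⋃ b ∈ B, ({u | b.1 + u ∈ K} \ D) := by
      intro u hu
      obtain ⟨b, hb, hbu⟩ := Set.mem_iUnion₂.1 (hB hu.1)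
      exact Set.mem_biUnion hb ⟨(interior_subset hbu : b.1 + u ∈ K), hu.2⟩
    refine (measure_mono hsub).trans ((measure_biUnion_finset_le _ _).trans ?_)
    rw [← nsmul_eq_mul, ← Finset.sum_const]
    refine Finset.sum_le_sum fun b hb => ?_
    have hDsub : D ⊆ {u | b.1 + u ∈ K} := by
      intro u hu
      refine hδB b hb ?_
      rw [mem_ball_iff_norm, add_sub_cancel_left]
      exact mem_ball_zero_iff.1 hu
    have hDfin : ν D ≠ ⊤ := ((measure_mono hDsub).trans (hν1 _).le).trans_lt
      ENNReal.one_lt_top |>.ne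
    rw [measure_sdiff hDsub Metric.isOpen_ball.measurableSet.nullMeasurableSet hDfin, hν1]
    exact tsub_le_iff_left.2 hνη
  have hCmass : ∀ n ∈ N, 1 ≤ ν (C n \ P) + B.card * ENNReal.ofReal η := by
    intro n hn
    rw [← hν1 (x n + τ • n)]
    refine (measure_mono (t := C n \ P ∪ P \ D) fun u hu => ?_).trans
      ((measure_union_le _ _).trans (by gcongr))
    by_cases huP : u ∈ P
    · exact Or.inr ⟨huP, fun h => hCball n hn u hu (Metric.ball_subset_ball hδτ h)⟩
    · exact Or.inl ⟨hu, huP⟩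
  have hdisj : (N : Set (EuclideanSpace ℝ (Fin d))).PairwiseDisjoint fun n => C n \ P := by
    intro n hn n' hn' hne
    refine Set.disjoint_left.2 fun u hu hu' => hu.2 ?_
    exact Set.mem_biUnion (x := (n, n')) (Finset.mem_offDiag.2 ⟨hn, hn', hne⟩) ⟨hu.1, hu'.1⟩
  have hsum : ∑ n ∈ N, ν (C n \ P) ≤ A.card := by
    rw [← measure_biUnion_finset hdisj
      fun n _ => (hclosed _).measurableSet.diff hPcomp.isClosed.measurableSet]
    have hsub : (⋃ n ∈ N, C n \ P) ⊆ ⋃ a ∈ A, {u | a + u ∈ K} := by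
      refine Set.iUnion₂_subset fun n hn u hu => ?_
      obtain ⟨a, ha, hau⟩ := Set.mem_iUnion₂.1 (hA (hCbound n hn hu.1))
      exact Set.mem_biUnion ha (interior_subset hau : a + u ∈ K)
    refine (measure_mono hsub).trans ((measure_biUnion_finset_le _ _).trans ?_)
    simp [hν1]
  have htotal : (k : ENNReal) ≤ A.card + k * (B.card * ENNReal.ofReal η) := by
    calc (k : ENNReal) = ∑ n ∈ N, 1 := by simp [hcard]
      _ ≤ ∑ n ∈ N, (ν (C n \ P) + B.card * ENNReal.ofReal η) := Finset.sum_le_sum hCmass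
      _ = ∑ n ∈ N, ν (C n \ P) + k * (B.card * ENNReal.ofReal η) := by
        rw [Finset.sum_add_distrib, Finset.sum_const, hcard, nsmul_eq_mul]
      _ ≤ _ := by gcongr
  have hreal : (k : ℝ) ≤ A.card + k * (B.card * η) := by
    have := ENNReal.toReal_mono (by finiteness) htotal
    rw [ENNReal.toReal_add (by finiteness) (by finiteness)] at this
    simpa [ENNReal.toReal_mul, ENNReal.toReal_ofReal hη0.le] using this
  have hhalf : (k : ℝ) * (B.card * η) ≤ 1 / 2 := by
    have hk0 : (0 : ℝ) < k := by positivity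
    rw [hη]
    have : (k : ℝ) * (B.card * (1 / (2 * k * (B.card + 1)))) = B.card / (B.card + 1) / 2 := by
      field_simp
    rw [this]
    gcongr
    rw [div_le_one (by positivity)]
    linarith
  rw [hk] at hreal hhalf
  push_cast at hreal hhalf
  linarith

theorem theorem1p2 (d : ℕ) (Ω : Set (EuclideanSpace ℝ (Fin d))) (hΩ : IsConvexBody Ω)
    (hspec : IsSpectral Ω) : IsConvexPolytope Ω := by
  obtain ⟨hmeas, -, hbdd, Λ, hΛ⟩ := hspec
  exact hΩ.isConvexPolytope_of_finite_regularNormals (hΩ.finite_regularNormals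
    fun δ η hδ hη => hΛ.exists_measure hmeas hΩ.nonempty_interior hδ hη)
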